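/- Let $I$ be a finite index set and, for each $i\in I$, let $\mathcal A_i$ be a unital C*-algebra (not necessarily finite-dimensional). Let $\mathcal A=\bigotimes_{i\in I}\mathcal A_i$ be their minimal (spatial) C*-tensor product: for faithful unital $*$-representations $\pi_i$ of $\mathcal A_i$ on Hilbert spaces $H_i$, it is the C*-algebra of operators on $\bigotimes_i H_i$ generated by the operators $1\otimes\cdots\otimes\pi_i(a)\otimes\cdots\otimes 1$ with $i\in I$, $a\in\mathcal A_i$ (the assertion below holds for every choice of such $\pi_i$). For each $i$ let $\tilde{\mathcal A}_i=\bigotimes_{j\ne i}\mathcal A_j$, viewed as the C*-subalgebra of $\mathcal A$ generated by $1_{\mathcal A}$ and the canonical copies of the $\mathcal A_j$ with $j\neq i$, and define seminorms on $\mathcal A$ by $$L_i(a)=2\inf\{\|a-c\| : c\in\tilde{\mathcal A}_i\},\qquad L_{qH}(a)=\max_{i\in I}L_i(a)$$ (with $L_{qH}=0$ if $I=\emptyset$). Let $M^0(\mathcal A)$ be the space of continuous linear functionals $\varphi:\mathcal A\to\mathbb C$ that vanish on $\mathbb C1_{\mathcal A}$, and let $\tilde{\mathcal A}_i^\perp\subseteq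 M^0(\mathcal A)$ be the subspace of the functionals that vanish on $\tilde{\mathcal A}_i$. For $\varphi\in M^0(\mathcal A)$ and for $\psi\in\tilde{\mathcal A}_i^\perp$ put $$\|\varphi\|_{qH}=\sup\{|\varphi(a)| : a\in\mathcal A,\ L_{qH}(a)\le 1\},\qquad \|\psi\|_i=\sup\{|\psi(a)| : a\in\mathcal A,\ L_i(a)\le 1\}.$$ **Theorem.** All these suprema are finite, and for every $\varphi\in M^0(\mathcal A)$ $$\|\varphi\|_{qH}=\inf\Big\{\sum_{i\in I}\|\varphi_i\|_i \;:\; \varphi_i\in\tilde{\mathcal A}_i^\perp\ (i\in I),\ \ \varphi=\sum_{i\in I}\varphi_i\Big\}.$$ -/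

import Mathlib

open scoped ENNReal TensorProduct InnerProductSpace ComplexOrder

namespace QuantumHamming

section HilbertTensor

variable {I : Type*} {H : I → Type*} [∀ i, NormedAddCommGroup (H i)]
  [∀ i, InnerProductSpace ℂ (H i)]

/-- The algebraic tensor product of the family `H`, as a type of its own: it carries the
inner product of the `H i`, not the projective norm that Mathlib puts on `⨂[ℂ] i, H i`. -/
def PreHilbertTensor (H : I → Type*) [∀ i, NormedAddCommGroup (H i)]
    [∀ i, InnerProductSpace ℂ (H i)] : Type _ :=
  ⨂[ℂ] i, H i

noncomputable instance : AddCommGroup (PreHilbertTensor H) :=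
  PiTensorProduct.instAddCommGroup (R := ℂ) (s := H)

noncomputable instance : Module ℂ (PreHilbertTensor H) :=
  PiTensorProduct.instModule (R := ℂ) (s := H)

/-- The elementary tensor `⨂ x i`. -/
noncomputable def tmul : MultilinearMap ℂ H (PreHilbertTensor H) :=
  PiTensorProduct.tprod ℂ

theorem exists_eq_sum (t : PreHilbertTensor H) :
    ∃ (s : Finset (∀ i, H i)) (c : (∀ i, H i) → ℂ), t = ∑ k : s, c k • tmul k.1 := by
  have h : t ∈ Submodule.span ℂ (Set.range (tmul (H := H))) := by
    have : Submodule.span ℂ (Set.range (tmul (H := H))) = ⊤ :=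
      PiTensorProduct.span_tprod_eq_top
    rw [this]; trivial
  obtain ⟨c, rfl⟩ := Finsupp.mem_span_range_iff_exists_finsupp.1 h
  exact ⟨c.support, c, (Finset.sum_coe_sort c.support fun k => c k • tmul k).symm⟩

open Classical in
/-- `1 ⊗ ⋯ ⊗ T ⊗ ⋯ ⊗ 1`, with `T` in position `i`, on the algebraic tensor product. -/
noncomputable def preSlot (i : I) (T : H i →L[ℂ] H i) :
    PreHilbertTensor H →ₗ[ℂ] PreHilbertTensor H :=
  PiTensorProduct.map
    (Function.update (fun j => (LinearMap.id : H j →ₗ[ℂ] H j)) i (T : H i →ₗ[ℂ] H i))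

open Classical in
theorem preSlot_tmul (i : I) (T : H i →L[ℂ] H i) (x : ∀ i, H i) :
    preSlot i T (tmul x) = tmul (Function.update x i (T (x i))) := by
  simp only [preSlot, tmul]
  erw [PiTensorProduct.map_tprod]
  congr 1
  ext j
  by_cases h : j = i
  · subst h; simp
  · simp [h]

theorem anti_ext {f g : PreHilbertTensor H →ₗ⋆[ℂ] ℂ} (h : ∀ z, f (tmul z) = g (tmul z)) :
    f = g := by
  ext t
  obtain ⟨s, c, rfl⟩ := exists_eq_sum t
  simp [h]

variable [Fintype I]

/-- The linear functional `⨂ z i ↦ ∏ ⟪x i, z i⟫`. -/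
noncomputable def innerFunctional (x : ∀ i, H i) : PreHilbertTensor H →ₗ[ℂ] ℂ :=
  PiTensorProduct.lift
    ((MultilinearMap.mkPiAlgebra ℂ I ℂ).compLinearMap fun i => (innerSL ℂ (x i)).toLinearMap)

theorem innerFunctional_tmul (x z : ∀ i, H i) :
    innerFunctional x (tmul z) = ∏ i, ⟪x i, z i⟫_ℂ := by
  simp only [innerFunctional, tmul]
  erw [PiTensorProduct.lift.tprod]
  simp

/-- The conjugate-linear functional `⨂ z i ↦ ∏ ⟪z i, x i⟫`. -/
noncomputable def innerAntiFunctional (x : ∀ i, H i) : PreHilbertTensor H →ₗ⋆[ℂ] ℂ where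
  toFun t := starRingEnd ℂ (innerFunctional x t)
  map_add' := by simp
  map_smul' := by simp

theorem innerAntiFunctional_tmul (x z : ∀ i, H i) :
    innerAntiFunctional x (tmul z) = ∏ i, ⟪z i, x i⟫_ℂ := by
  simp [innerAntiFunctional, innerFunctional_tmul]

/-- `⨂ x i ↦ (t ↦ ⟪t, ⨂ x i⟫)`, extended linearly. -/
noncomputable def innerMap : PreHilbertTensor H →ₗ[ℂ] (PreHilbertTensor H →ₗ⋆[ℂ] ℂ) :=
  PiTensorProduct.lift
    { toFun := innerAntiFunctional
      map_update_add' := by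
        intro _ m i x y
        refine anti_ext fun z => ?_
        simp only [LinearMap.add_apply, innerAntiFunctional_tmul]
        rw [← Finset.mul_prod_erase _ _ (Finset.mem_univ i),
          ← Finset.mul_prod_erase _ _ (Finset.mem_univ i),
          ← Finset.mul_prod_erase _ _ (Finset.mem_univ i)]
        simp only [Function.update_self, inner_add_right, add_mul]
        congr 2 <;>
        · refine Finset.prod_congr rfl fun j hj => ?_
          simp [Function.update_of_ne (Finset.ne_of_mem_erase hj)]
      map_update_smul' := by
        intro _ m i c x
        refine anti_ext fun z => ?_
        simp only [LinearMap.smul_apply, innerAntiFunctional_tmul]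
        rw [← Finset.mul_prod_erase _ _ (Finset.mem_univ i),
          ← Finset.mul_prod_erase _ _ (Finset.mem_univ i)]
        simp only [Function.update_self, inner_smul_right, smul_eq_mul, mul_assoc]
        congr 2
        refine Finset.prod_congr rfl fun j hj => ?_
        simp [Function.update_of_ne (Finset.ne_of_mem_erase hj)] }

theorem innerMap_tmul (x z : ∀ i, H i) :
    innerMap (tmul x) (tmul z) = ∏ i, ⟪z i, x i⟫_ℂ := by
  rw [← innerAntiFunctional_tmul]
  simp only [innerMap, tmul]
  erw [PiTensorProduct.lift.tprod]
  rfl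

theorem innerMap_sum (s : Finset (∀ i, H i)) (c : (∀ i, H i) → ℂ) (u v : s → ∀ i, H i) :
    innerMap (∑ k : s, c k • tmul (v k)) (∑ k : s, c k • tmul (u k)) =
      star (fun k : s => c k) ⬝ᵥ (Matrix.of fun k l : s => ∏ i, ⟪u k i, v l i⟫_ℂ).mulVec
        (fun k : s => c k) := by
  simp only [map_sum, map_smul, LinearMap.sum_apply, LinearMap.smul_apply, map_smulₛₗ,
    innerMap_tmul, dotProduct, Matrix.mulVec, Matrix.of_apply, smul_eq_mul, Pi.star_apply,
    Finset.mul_sum]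
  refine (Finset.sum_congr rfl fun k _ => Finset.sum_congr rfl fun l _ => ?_)
  simp only [RCLike.star_def]
  ring

theorem posSemidef_prod {n : Type*} [Fintype n] (M : I → Matrix n n ℂ)
    (hM : ∀ i, (M i).PosSemidef) : (Matrix.of fun k l => ∏ i, M i k l).PosSemidef := by
  classical
  suffices h : ∀ s : Finset I, (Matrix.of fun k l => ∏ i ∈ s, M i k l).PosSemidef from h _
  intro s
  induction s using Finset.induction_on with
  | empty =>
    have := Matrix.posSemidef_gram ℂ (fun _ : n => (1 : ℂ))
    have e : (Matrix.of fun k l => ∏ i ∈ (∅ : Finset I), M i k l) =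
        Matrix.gram ℂ (fun _ : n => (1 : ℂ)) := by
      ext k l
      simp
    rw [e]
    exact this
  | insert a s ha ih =>
    have := (hM a).hadamard ih
    have e : (Matrix.of fun k l => ∏ i ∈ insert a s, M i k l) =
        (M a).hadamard (Matrix.of fun k l => ∏ i ∈ s, M i k l) := by
      ext k l
      simp [Finset.prod_insert ha]
    rw [e]
    exact this

/-- The inner product determined by `⟪⨂ x i, ⨂ y i⟫ = ∏ ⟪x i, y i⟫`. -/
@[reducible]
noncomputable def innerCore : PreInnerProductSpace.Core ℂ (PreHilbertTensor H) where
  inner s t := innerMap t s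
  conj_inner_symm s t := by
    obtain ⟨S, c, rfl⟩ := exists_eq_sum s
    obtain ⟨S', c', rfl⟩ := exists_eq_sum t
    simp only [map_sum, map_smul, LinearMap.sum_apply, LinearMap.smul_apply, map_smulₛₗ,
      innerMap_tmul, smul_eq_mul, map_mul, map_prod, inner_conj_symm, Complex.conj_conj]
    simp only [Finset.mul_sum]
    rw [Finset.sum_comm]
    simp only [mul_left_comm]
  re_inner_nonneg t := by
    obtain ⟨S, c, rfl⟩ := exists_eq_sum t
    rw [innerMap_sum S c (fun k => k.1) (fun k => k.1)]
    have := (posSemidef_prod _ fun i : I =>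
      Matrix.posSemidef_gram ℂ fun k : S => k.1 i).dotProduct_mulVec_nonneg (fun k : S => c k)
    exact (RCLike.nonneg_iff.1 this).1
  add_left s s' t := by simp
  smul_left s t c := by simp

noncomputable instance : SeminormedAddCommGroup (PreHilbertTensor H) :=
  @InnerProductSpace.Core.toSeminormedAddCommGroup ℂ _ _ _ _ innerCore

noncomputable instance : InnerProductSpace ℂ (PreHilbertTensor H) :=
  InnerProductSpace.ofCore innerCore

theorem inner_tmul (x y : ∀ i, H i) :
    ⟪tmul x, tmul y⟫_ℂ = ∏ i, ⟪x i, y i⟫_ℂ :=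
  innerMap_tmul y x

/-- The Hilbert space tensor product `⨂ H i` of a finite family of Hilbert spaces: the
completion of the algebraic tensor product for `⟪⨂ x i, ⨂ y i⟫ = ∏ ⟪x i, y i⟫`. -/
abbrev HilbertTensor (H : I → Type*) [∀ i, NormedAddCommGroup (H i)]
    [∀ i, InnerProductSpace ℂ (H i)] : Type _ :=
  UniformSpace.Completion (PreHilbertTensor H)

theorem norm_preSlot_le (i : I) (T : H i →L[ℂ] H i) (t : PreHilbertTensor H) :
    ‖preSlot i T t‖ ≤ ‖T‖ * ‖t‖ := by
  classical
  obtain ⟨S, c, rfl⟩ := exists_eq_sum t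
  refine le_of_sq_le_sq ?_ (by positivity)
  rw [mul_pow]
  have e1 : preSlot i T (∑ k : S, c k • tmul k.1) =
      ∑ k : S, c k • tmul (Function.update k.1 i (T (k.1 i))) := by
    simp [preSlot_tmul]
  rw [e1, norm_sq_eq_re_inner (𝕜 := ℂ)
      (∑ k : S, c k • tmul (Function.update k.1 i (T (k.1 i)))),
    norm_sq_eq_re_inner (𝕜 := ℂ) (∑ k : S, c k • tmul k.1)]
  change RCLike.re (innerMap _ _) ≤ _ * RCLike.re (innerMap _ _)
  rw [innerMap_sum S c (fun k => k.1) (fun k => k.1),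
    innerMap_sum S c (fun k => Function.update k.1 i (T (k.1 i)))
      (fun k => Function.update k.1 i (T (k.1 i)))]
  let M : I → Matrix S S ℂ := Function.update (fun j => Matrix.gram ℂ fun k : S => k.1 j) i
    (((‖T‖ ^ 2 : ℝ) : ℂ) • Matrix.gram ℂ (fun k : S => k.1 i) -
      Matrix.gram ℂ (fun k : S => (T (k.1 i) : H i)))
  have hM : ∀ j, (M j).PosSemidef := by
    intro j
    by_cases hj : j = i
    · subst hj
      simp only [M, Function.update_self]
      refine .of_dotProduct_mulVec_nonneg ?_ fun x => ?_
      · refine Matrix.IsHermitian.sub ?_ (Matrix.isHermitian_gram ℂ _)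
        rw [Matrix.IsHermitian, Matrix.conjTranspose_smul, Matrix.isHermitian_gram ℂ _]
        simp
      · rw [Matrix.sub_mulVec, dotProduct_sub, Matrix.smul_mulVec, dotProduct_smul,
          Matrix.star_dotProduct_gram_mulVec, Matrix.star_dotProduct_gram_mulVec]
        simp only [← map_smul, ← map_sum]
        rw [inner_self_eq_norm_sq_to_K, inner_self_eq_norm_sq_to_K]
        have h := T.le_opNorm (∑ k, x k • k.1 j)
        have h2 := pow_le_pow_left₀ (norm_nonneg _) h 2
        rw [mul_pow] at h2
        simp only [smul_eq_mul, sub_nonneg]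
        have h3 := Complex.real_le_real.2 h2
        push_cast at h3 ⊢
        exact h3
    · simp only [M, Function.update_of_ne hj]
      exact Matrix.posSemidef_gram ℂ _
  have key := (RCLike.nonneg_iff.1
    ((posSemidef_prod M hM).dotProduct_mulVec_nonneg (fun k : S => c k))).1
  have e2 : (Matrix.of fun k l => ∏ j, M j k l) =
      ((‖T‖ ^ 2 : ℝ) : ℂ) • (Matrix.of fun k l : S => ∏ j, ⟪k.1 j, l.1 j⟫_ℂ) -
      Matrix.of fun k l : S => ∏ j, ⟪Function.update k.1 i (T (k.1 i)) j,
        Function.update l.1 i (T (l.1 i)) j⟫_ℂ := by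
    ext k l
    simp only [Matrix.of_apply, Matrix.sub_apply, Matrix.smul_apply]
    rw [← Finset.mul_prod_erase _ _ (Finset.mem_univ i),
      ← Finset.mul_prod_erase _ _ (Finset.mem_univ i),
      ← Finset.mul_prod_erase _ _ (Finset.mem_univ i)]
    have a1 : ∏ j ∈ Finset.univ.erase i, M j k l =
        ∏ j ∈ Finset.univ.erase i, ⟪k.1 j, l.1 j⟫_ℂ :=
      Finset.prod_congr rfl fun j hj => by
        simp [M, Function.update_of_ne (Finset.ne_of_mem_erase hj)]
    have a2 : ∏ j ∈ Finset.univ.erase i, ⟪Function.update k.1 i (T (k.1 i)) j,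
          Function.update l.1 i (T (l.1 i)) j⟫_ℂ =
        ∏ j ∈ Finset.univ.erase i, ⟪k.1 j, l.1 j⟫_ℂ :=
      Finset.prod_congr rfl fun j hj => by
        simp [Function.update_of_ne (Finset.ne_of_mem_erase hj)]
    rw [a1, a2]
    simp [M, sub_mul, mul_assoc]
  rw [e2, Matrix.sub_mulVec, dotProduct_sub, Matrix.smul_mulVec, dotProduct_smul,
    map_sub, sub_nonneg, smul_eq_mul] at key
  refine key.trans_eq ?_
  exact RCLike.re_ofReal_mul _ _

/-- The bounded operator `1 ⊗ ⋯ ⊗ T ⊗ ⋯ ⊗ 1`, with `T` in position `i`, on `⨂ H i`. -/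
noncomputable def slot (i : I) (T : H i →L[ℂ] H i) : HilbertTensor H →L[ℂ] HilbertTensor H :=
  ((preSlot i T).mkContinuous ‖T‖ (norm_preSlot_le i T)).completion

open Classical in
theorem slot_tmul (i : I) (T : H i →L[ℂ] H i) (x : ∀ i, H i) :
    slot i T (tmul x : PreHilbertTensor H) =
      (tmul (Function.update x i (T (x i))) : PreHilbertTensor H) := by
  rw [← preSlot_tmul]
  exact ContinuousLinearMap.completion_apply_coe _ _

end HilbertTensor

section Hamming

variable {I : Type*} [Fintype I] {A : I → Type*} [∀ i, CStarAlgebra (A i)]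
  {H : I → Type*} [∀ i, NormedAddCommGroup (H i)] [∀ i, InnerProductSpace ℂ (H i)]
  [∀ i, CompleteSpace (H i)] (π : ∀ i, A i →⋆ₐ[ℂ] (H i →L[ℂ] H i))

/-- The operators `1 ⊗ ⋯ ⊗ π i a ⊗ ⋯ ⊗ 1` on `⨂ H i`, for all positions `i` and all `a : A i`. -/
def generators : Set (HilbertTensor H →L[ℂ] HilbertTensor H) :=
  {T | ∃ (i : I) (a : A i), T = slot i (π i a)}

/-- The norm closure of the star algebra generated by the operators
`1 ⊗ ⋯ ⊗ π i a ⊗ ⋯ ⊗ 1`, that is, of the span of the operators `⨂ π i (a i)`. -/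
noncomputable def spatialSubalgebra :
    StarSubalgebra ℂ (HilbertTensor H →L[ℂ] HilbertTensor H) :=
  (StarAlgebra.adjoin ℂ (generators π)).topologicalClosure

instance : IsClosed (spatialSubalgebra π : Set (HilbertTensor H →L[ℂ] HilbertTensor H)) :=
  StarSubalgebra.isClosed_topologicalClosure _

/-- The minimal (spatial) C⋆-tensor product `⨂ A i` of unital C⋆-algebras that are faithfully
represented by `π i` on Hilbert spaces `H i`: the C⋆-algebra of operators on `⨂ H i` generated
by the operators `1 ⊗ ⋯ ⊗ π i a ⊗ ⋯ ⊗ 1`, with the operator norm. -/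
def MinTensor : Type _ := spatialSubalgebra π

noncomputable instance : CStarAlgebra (MinTensor π) :=
  inferInstanceAs (CStarAlgebra (spatialSubalgebra π))

/-- The canonical copy `1 ⊗ ⋯ ⊗ a ⊗ ⋯ ⊗ 1` in `⨂ A i` of an element `a` of `A i`. -/
noncomputable def embed (i : I) (a : A i) : MinTensor π :=
  ⟨slot i (π i a), StarSubalgebra.le_topologicalClosure _
    (StarAlgebra.subset_adjoin ℂ _ ⟨i, a, rfl⟩)⟩

/-- The C⋆-subalgebra `⨂_{j ≠ i} A j` of `⨂ A i`, generated by the canonical copies of the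
`A j` with `j ≠ i`. -/
noncomputable def tilde (i : I) : StarSubalgebra ℂ (MinTensor π) :=
  (StarAlgebra.adjoin ℂ {x | ∃ (j : I) (a : A j), j ≠ i ∧ x = embed π j a}).topologicalClosure

/-- `L_i(a) = 2 inf {‖a - c‖ : c ∈ ⨂_{j ≠ i} A j}`. -/
noncomputable def partialSeminorm (i : I) (a : MinTensor π) : ℝ :=
  2 * ⨅ c : tilde π i, ‖a - (c : MinTensor π)‖

/-- The quantum Hamming seminorm `L_qH(a) = max_i L_i(a)`. -/
noncomputable def hammingSeminorm (a : MinTensor π) : ℝ :=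
  ⨆ i, partialSeminorm π i a

/-- The bounded linear functionals on `⨂ A i` that vanish on the scalar multiples of `1`. -/
def M0 : Submodule ℂ (MinTensor π →L[ℂ] ℂ) where
  carrier := {φ | ∀ z : ℂ, φ (z • 1) = 0}
  add_mem' := by intro φ ψ hφ hψ z; rw [add_apply, hφ, hψ, add_zero]
  zero_mem' := by intro z; rfl
  smul_mem' := by intro c φ hφ z; rw [smul_apply, hφ, smul_zero]

/-- The annihilator of `⨂_{j ≠ i} A j` in the space `M0` of functionals. -/
def tildePerp (i : I) : Submodule ℂ (M0 π) where
  carrier := {φ | ∀ c ∈ tilde π i, (φ : MinTensor π →L[ℂ] ℂ) c = 0}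
  add_mem' := by
    intro φ ψ hφ hψ c hc
    rw [Submodule.coe_add, add_apply, hφ c hc, hψ c hc, add_zero]
  zero_mem' := by intro c _; rfl
  smul_mem' := by
    intro z φ hφ c hc
    rw [Submodule.coe_smul, smul_apply, hφ c hc, smul_zero]

/-- The dual norm `sup {|φ(a)| : L(a) ≤ 1}` of a functional with respect to a seminorm `L`, with
the value `∞` if the supremum is infinite. -/
noncomputable def dualNorm (L : MinTensor π → ℝ) (φ : M0 π) : ℝ≥0∞ :=
  ⨆ (a : MinTensor π) (_ : L a ≤ 1), ‖(φ : MinTensor π →L[ℂ] ℂ) a‖ₑ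

end Hamming

end QuantumHamming

/-!
Write `L_i(a)` as the norm of twice the class of `a` in `⨂ A i ⧸ ⨂_{j ≠ i} A j`. Then `L_qH` is
the norm of the image of `a` in the `ℓ^∞`-sum of these quotients, whose dual is the `ℓ¹`-sum of
the annihilators of the `⨂_{j ≠ i} A j`; extending `φ` from the image by Hahn–Banach gives the
optimal decomposition.

This requires that `φ` be bounded by `L_qH`. For unit vectors `ξ i` in `H i`, the slice map
in position `i` evaluates the `i`-th tensor factor in the vector state of `ξ i`; it is contractive
and fixes `⨂_{j ≠ i} A j`, so it moves `a` by at most `L_i(a)`. Composing all the slice maps turns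
`a` into `⟨ξ, a ξ⟩ 1` with `ξ = ⨂ ξ i`, and telescoping bounds the distance from `a` to the scalars
by `∑ i, L_i(a)`.
-/

namespace QuantumHamming

section Duality

variable {ι 𝕜 X : Type*} [RCLike 𝕜]

theorem norm_le_mul_of_forall_norm_le_one {E F : Type*} [SeminormedAddCommGroup E]
    [NormedSpace 𝕜 E] [SeminormedAddCommGroup F] [NormedSpace 𝕜 F] [AddCommGroup X] [Module 𝕜 X]
    {T : X →ₗ[𝕜] E} {f : X →ₗ[𝕜] F} {K : ℝ} (h : ∀ a, ‖T a‖ ≤ 1 → ‖f a‖ ≤ K) (a : X) :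
    ‖f a‖ ≤ K * ‖T a‖ := by
  have hr : ∀ r ∈ Set.Ioi ‖T a‖, ‖f a‖ ≤ K * r := fun r (hr : ‖T a‖ < r) => by
    have hr₀ : 0 < r := (norm_nonneg _).trans_lt hr
    have h' := h ((r⁻¹ : 𝕜) • a) <| by
      simpa [norm_smul, abs_of_pos hr₀, inv_mul_le_iff₀ hr₀] using hr.le
    simpa [norm_smul, abs_of_pos hr₀, inv_mul_le_iff₀ hr₀, mul_comm r] using h'
  exact ge_of_tendsto (((continuous_const_mul K).tendsto _).mono_left nhdsWithin_le_nhds)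
    (eventually_nhdsWithin_of_forall hr)

variable [Fintype ι]

theorem sum_le_of_forall_lt_sum_le {f : ι → ℝ} {C : ℝ}
    (h : ∀ g : ι → ℝ, (∀ i, g i < f i) → ∑ i, g i ≤ C) : ∑ i, f i ≤ C := by
  have hf : f ∈ closure (Set.univ.pi fun i => Set.Iio (f i)) := by
    simp [closure_pi_set]
  have hsub : (Set.univ.pi fun i => Set.Iio (f i)) ⊆ {g | ∑ i, g i ≤ C} :=
    fun g hg => h g fun i => hg i (Set.mem_univ i)
  exact closure_minimal hsub (isClosed_le (by fun_prop) continuous_const) hf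

theorem le_sum_of_forall_gt_le_sum {f : ι → ℝ} {C : ℝ}
    (h : ∀ g : ι → ℝ, (∀ i, f i < g i) → C ≤ ∑ i, g i) : C ≤ ∑ i, f i := by
  simpa using sum_le_of_forall_lt_sum_le (f := -f) (C := -C) fun g hg => by
    simpa [le_neg] using h (-g) fun i => lt_neg.1 (hg i)

theorem exists_norm_le_one_and_lt_re_apply {E : Type*} [NormedAddCommGroup E]
    [NormedSpace 𝕜 E] (f : StrongDual 𝕜 E) {r : ℝ} (hr : r < ‖f‖) :
    ∃ x, ‖x‖ ≤ 1 ∧ r < RCLike.re (f x) := by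
  obtain ⟨x, hx, hrx⟩ := f.exists_lt_apply_of_lt_opNorm hr
  obtain ⟨u, hu, hux⟩ := RCLike.exists_norm_eq_mul_self (f x)
  refine ⟨u • x, by simpa [norm_smul, hu] using hx.le, ?_⟩
  rwa [map_smul, smul_eq_mul, ← hux, RCLike.ofReal_re]

variable {E : ι → Type*} [∀ i, NormedAddCommGroup (E i)] [∀ i, NormedSpace 𝕜 (E i)]

theorem sum_norm_comp_single_le [DecidableEq ι] (F : StrongDual 𝕜 (∀ i, E i)) :
    ∑ i, ‖F ∘L ContinuousLinearMap.single 𝕜 E i‖ ≤ ‖F‖ := by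
  refine sum_le_of_forall_lt_sum_le fun g hg => ?_
  choose x hx hgx using fun i => exists_norm_le_one_and_lt_re_apply _ (hg i)
  calc ∑ i, g i ≤ ∑ i, RCLike.re (F (Pi.single i (x i))) :=
        Finset.sum_le_sum fun i _ => (hgx i).le
    _ = RCLike.re (F x) := by
        rw [← map_sum, ← map_sum, Finset.univ_sum_single]
    _ ≤ ‖F x‖ := RCLike.re_le_norm _
    _ ≤ ‖F‖ := F.unit_le_opNorm x ((pi_norm_le_iff_of_nonneg zero_le_one).2 hx)

theorem exists_sum_comp_eq [AddCommGroup X] [Module 𝕜 X] {T : ∀ i, X →ₗ[𝕜] E i}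
    {φ : X →ₗ[𝕜] 𝕜} {K : ℝ} (hK : 0 ≤ K) (hφ : ∀ a, ‖φ a‖ ≤ K * ‖fun i => T i a‖) :
    ∃ F : ∀ i, StrongDual 𝕜 (E i), (∀ a, φ a = ∑ i, F i (T i a)) ∧ ∑ i, ‖F i‖ ≤ K := by
  classical
  set f := φ.compLeftInverse (LinearMap.pi T)
  have hf (a : X) : f ⟨LinearMap.pi T a, a, rfl⟩ = φ a :=
    φ.compLeftInverse_apply_of_bdd _ ⟨K, hφ⟩ a _ rfl
  have hfK : ‖f‖ ≤ K := f.opNorm_le_bound hK <| by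
    rintro ⟨_, a, rfl⟩
    exact (hf a).symm ▸ hφ a
  obtain ⟨F, hFf, hF⟩ := exists_extension_norm_eq _ f
  refine ⟨fun i => F ∘L ContinuousLinearMap.single 𝕜 E i, fun a => ?_,
    (sum_norm_comp_single_le F).trans (hF.trans_le hfK)⟩
  calc φ a = F (LinearMap.pi T a) := by rw [← hf, ← hFf]
    _ = ∑ i, F (Pi.single i (T i a)) := by
      rw [← map_sum, Finset.univ_sum_single]; rfl

end Duality

section Kraus

variable {ι 𝕜 E G : Type*} [RCLike 𝕜] [NormedAddCommGroup E] [InnerProductSpace 𝕜 E]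
  [NormedAddCommGroup G] [InnerProductSpace 𝕜 G] (u : ι → E →L[𝕜] G)
  (hu : ∀ v (s : Finset ι), ∑ l ∈ s, ‖u l v‖ ^ 2 ≤ ‖v‖ ^ 2)

/-- The column operator `v ↦ (u l v)_l` of a family of operators with `∑ l, ‖u l v‖² ≤ ‖v‖²`, with
values in the `ℓ²`-sum of copies of `G`. -/
noncomputable def columnOperator : E →L[𝕜] lp (fun _ : ι => G) 2 :=
  LinearMap.mkContinuous
    { toFun v := ⟨fun l => u l v, memℓp_gen' fun s => by simpa using hu v s⟩
      map_add' v w := by ext l; exact map_add (u l) v w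
      map_smul' c v := by ext l; exact map_smul (u l) c v }
    1 fun v => lp.norm_le_of_forall_sum_le (by simp) (by positivity) fun s => by
      simpa using hu v s

theorem norm_columnOperator_le : ‖columnOperator u hu‖ ≤ 1 :=
  LinearMap.mkContinuous_norm_le _ zero_le_one _

variable [CompleteSpace E] [CompleteSpace G]

open ContinuousLinearMap (adjoint)

/-- The Kraus map `T ↦ ∑ l, (u l)† T (u l)`, encoded as the compression by the column operator of
the diagonal action of `T` on the `ℓ²`-sum: the operator series itself need not converge in norm. -/
noncomputable def krausMap : (G →L[𝕜] G) →ₗ[𝕜] (E →L[𝕜] E) where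
  toFun T := adjoint (columnOperator u hu) ∘L
    lp.mapCLM 2 (fun _ => T) (norm_nonneg T) (fun _ => le_rfl) ∘L columnOperator u hu
  map_add' S T := by
    rw [← ContinuousLinearMap.comp_add, ← ContinuousLinearMap.add_comp]
    rfl
  map_smul' c T := by
    rw [RingHom.id_apply, ← ContinuousLinearMap.comp_smul, ← ContinuousLinearMap.smul_comp]
    rfl

theorem norm_krausMap_le (T : G →L[𝕜] G) : ‖krausMap u hu T‖ ≤ ‖T‖ := by
  have hU := norm_columnOperator_le u hu
  calc ‖krausMap u hu T‖
      ≤ ‖adjoint (columnOperator u hu)‖ *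
          (‖lp.mapCLM 2 (fun _ : ι => T) (norm_nonneg T) fun _ => le_rfl‖ *
            ‖columnOperator u hu‖) :=
        (ContinuousLinearMap.opNorm_comp_le _ _).trans
          (mul_le_mul_of_nonneg_left (ContinuousLinearMap.opNorm_comp_le _ _) (norm_nonneg _))
    _ ≤ 1 * (‖T‖ * 1) := by
        gcongr
        · rwa [LinearIsometryEquiv.norm_map]
        · exact lp.norm_mapCLM_le _ _ _ _
    _ = ‖T‖ := by ring

theorem hasSum_inner_krausMap (T : G →L[𝕜] G) (v w : E) :
    HasSum (fun l => ⟪u l w, T (u l v)⟫_𝕜) ⟪w, krausMap u hu T v⟫_𝕜 := by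
  have h := lp.hasSum_inner (𝕜 := 𝕜) (columnOperator u hu w)
    (lp.mapCLM 2 (fun _ => T) (norm_nonneg T) (fun _ => le_rfl) (columnOperator u hu v))
  rw [← ContinuousLinearMap.adjoint_inner_right] at h
  exact h

end Kraus

section Slot

variable {I : Type*} [Fintype I] {H : I → Type*} [∀ i, NormedAddCommGroup (H i)]
  [∀ i, InnerProductSpace ℂ (H i)]

/-- The elementary tensor `⨂ x i`, as a vector of the completed tensor product. -/
noncomputable def pureTensor : MultilinearMap ℂ H (HilbertTensor H) :=
  (UniformSpace.Completion.toComplₗᵢ (𝕜 := ℂ)).toLinearMap.compMultilinearMap tmul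

theorem inner_pureTensor (x y : ∀ i, H i) :
    ⟪pureTensor x, pureTensor y⟫_ℂ = ∏ i, ⟪x i, y i⟫_ℂ :=
  (UniformSpace.Completion.inner_coe _ _).trans (inner_tmul x y)

theorem inner_pureTensor_update_right [DecidableEq I] (x y : ∀ i, H i) (i : I) (v : H i) :
    ⟪pureTensor x, pureTensor (Function.update y i v)⟫_ℂ =
      ⟪x i, v⟫_ℂ * ∏ j ∈ Finset.univ \ {i}, ⟪x j, y j⟫_ℂ := by
  simp_rw [inner_pureTensor, Function.apply_update (fun j w => ⟪x j, w⟫_ℂ)]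
  exact Finset.prod_update_of_mem (Finset.mem_univ i) _ _

theorem inner_pureTensor_update_left [DecidableEq I] (x y : ∀ i, H i) (i : I) (v : H i) :
    ⟪pureTensor (Function.update x i v), pureTensor y⟫_ℂ =
      ⟪v, y i⟫_ℂ * ∏ j ∈ Finset.univ \ {i}, ⟪x j, y j⟫_ℂ := by
  simp_rw [inner_pureTensor, Function.apply_update (fun j w => ⟪w, y j⟫_ℂ)]
  exact Finset.prod_update_of_mem (Finset.mem_univ i) _ _

theorem dense_span_range_pureTensor :
    Dense (Submodule.span ℂ (Set.range (pureTensor (H := H))) : Set (HilbertTensor H)) := by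
  refine UniformSpace.Completion.denseRange_coe.mono ?_
  rintro _ ⟨t, rfl⟩
  obtain ⟨s, c, rfl⟩ := exists_eq_sum t
  rw [← UniformSpace.Completion.coe_toComplₗᵢ (𝕜 := ℂ), map_sum]
  refine Submodule.sum_mem _ fun k _ => ?_
  rw [map_smul]
  exact Submodule.smul_mem _ _ (Submodule.subset_span ⟨k.1, rfl⟩)

theorem ext_pureTensor {F : Type*} [NormedAddCommGroup F] [NormedSpace ℂ F]
    {S T : HilbertTensor H →L[ℂ] F} (h : ∀ x, S (pureTensor x) = T (pureTensor x)) : S = T :=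
  ContinuousLinearMap.ext_on dense_span_range_pureTensor (Set.forall_mem_range.2 h)

theorem ext_inner_pureTensor {v w : HilbertTensor H}
    (h : ∀ x, ⟪pureTensor x, v⟫_ℂ = ⟪pureTensor x, w⟫_ℂ) : v = w := by
  have hvw : innerSL ℂ v = innerSL ℂ w := ext_pureTensor fun x => by
    simpa using congrArg (starRingEnd ℂ) (h x)
  exact ext_inner_right ℂ fun u => DFunLike.congr_fun hvw u

theorem ext_inner_pureTensor_map {S T : HilbertTensor H →L[ℂ] HilbertTensor H}
    (h : ∀ x y, ⟪pureTensor y, S (pureTensor x)⟫_ℂ = ⟪pureTensor y, T (pureTensor x)⟫_ℂ) :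
    S = T :=
  ext_pureTensor fun x => ext_inner_pureTensor (h x)

theorem slot_pureTensor [DecidableEq I] (i : I) (T : H i →L[ℂ] H i) (x : ∀ i, H i) :
    slot i T (pureTensor x) = pureTensor (Function.update x i (T (x i))) := by
  change slot i T (tmul x) = ((tmul _ : PreHilbertTensor H) : HilbertTensor H)
  convert slot_tmul i T x

theorem slot_commute {i j : I} (h : i ≠ j) (S : H i →L[ℂ] H i) (T : H j →L[ℂ] H j) :
    Commute (slot i S) (slot j T) := by
  classical
  refine ext_pureTensor fun x => ?_
  simp only [mul_apply_eq_comp, slot_pureTensor, Function.update_of_ne h,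
    Function.update_of_ne h.symm]
  rw [Function.update_comm h]

variable [∀ i, CompleteSpace (H i)]

theorem star_slot (i : I) (T : H i →L[ℂ] H i) : star (slot i T) = slot i (star T) := by
  classical
  refine ext_inner_pureTensor_map fun x y => ?_
  rw [ContinuousLinearMap.star_eq_adjoint, ContinuousLinearMap.adjoint_inner_right,
    slot_pureTensor, slot_pureTensor, inner_pureTensor_update_left,
    inner_pureTensor_update_right, ContinuousLinearMap.star_eq_adjoint,
    ContinuousLinearMap.adjoint_inner_right]

/-- The embedding `T ↦ 1 ⊗ ⋯ ⊗ T ⊗ ⋯ ⊗ 1` in position `i`, as a unital `⋆`-homomorphism. -/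
noncomputable def slotStarAlgHom (i : I) :
    (H i →L[ℂ] H i) →⋆ₐ[ℂ] (HilbertTensor H →L[ℂ] HilbertTensor H) where
  toFun := slot i
  map_one' := by
    classical
    exact ext_pureTensor fun x => by simp [slot_pureTensor]
  map_mul' S T := by
    classical
    exact ext_pureTensor fun x => by simp [slot_pureTensor]
  map_zero' := by
    classical
    exact ext_pureTensor fun x => by simp [slot_pureTensor]
  map_add' S T := by
    classical
    exact ext_pureTensor fun x => by simp [slot_pureTensor]
  commutes' c := by
    classical
    exact ext_pureTensor fun x => by simp [slot_pureTensor, Algebra.algebraMap_eq_smul_one]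
  map_star' T := (star_slot i T).symm

theorem slotStarAlgHom_apply (i : I) (T : H i →L[ℂ] H i) : slotStarAlgHom i T = slot i T := rfl

end Slot

section Slice

open InnerProductSpace (rankOne)

theorem isStarProjection_sum_rankOne {ι 𝕜 E : Type*} [RCLike 𝕜] [NormedAddCommGroup E]
    [InnerProductSpace 𝕜 E] [CompleteSpace E] {e : ι → E} (he : Orthonormal 𝕜 e)
    (s : Finset ι) : IsStarProjection (∑ l ∈ s, rankOne 𝕜 (e l) (e l)) where
  isIdempotentElem := by
    classical
    simp_rw [IsIdempotentElem, Finset.sum_mul_sum, ContinuousLinearMap.mul_def,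
      InnerProductSpace.rankOne_comp_rankOne, orthonormal_iff_ite.1 he, ite_smul, one_smul,
      zero_smul]
    exact Finset.sum_congr rfl fun l hl => by simp [hl]
  isSelfAdjoint := isSelfAdjoint_sum s fun l _ =>
    (InnerProductSpace.isStarProjection_rankOne_self (he.1 l)).isSelfAdjoint

variable {I : Type*} [Fintype I] {H : I → Type*} [∀ i, NormedAddCommGroup (H i)]
  [∀ i, InnerProductSpace ℂ (H i)] [∀ i, CompleteSpace (H i)]

theorem norm_sq_slot_apply (i : I) (T : H i →L[ℂ] H i) (v : HilbertTensor H) :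
    ‖slot i T v‖ ^ 2 = RCLike.re ⟪v, slot i (star T * T) v⟫_ℂ := by
  rw [← slotStarAlgHom_apply, ← slotStarAlgHom_apply, map_mul, map_star, mul_apply_eq_comp,
    ContinuousLinearMap.star_eq_adjoint, ContinuousLinearMap.adjoint_inner_right,
    inner_self_eq_norm_sq]

theorem sum_norm_sq_slot_rankOne_le {ι : Type*} {i : I} {e : ι → H i} (he : Orthonormal ℂ e)
    {ξ : H i} (hξ : ‖ξ‖ = 1) (v : HilbertTensor H) (s : Finset ι) :
    ∑ l ∈ s, ‖slot i (rankOne ℂ ξ (e l)) v‖ ^ 2 ≤ ‖v‖ ^ 2 := by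
  have hstar (l : ι) : star (rankOne ℂ ξ (e l)) * rankOne ℂ ξ (e l) = rankOne ℂ (e l) (e l) := by
    rw [ContinuousLinearMap.star_eq_adjoint, InnerProductSpace.adjoint_rankOne,
      ContinuousLinearMap.mul_def, InnerProductSpace.rankOne_comp_rankOne,
      inner_self_eq_norm_sq_to_K, hξ]
    simp
  set P := slot i (∑ l ∈ s, rankOne ℂ (e l) (e l))
  have hP : ‖P‖ ≤ 1 := ((isStarProjection_sum_rankOne he s).map (slotStarAlgHom i)).norm_le
  calc ∑ l ∈ s, ‖slot i (rankOne ℂ ξ (e l)) v‖ ^ 2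
      = RCLike.re ⟪v, P v⟫_ℂ := by
        simp_rw [norm_sq_slot_apply, hstar, P, ← slotStarAlgHom_apply, map_sum, sum_apply,
          inner_sum, map_sum]
    _ ≤ ‖v‖ * ‖P v‖ := (RCLike.re_le_norm _).trans (norm_inner_le_norm _ _)
    _ ≤ ‖v‖ * ‖v‖ := by gcongr; exact P.le_of_opNorm_le_of_le hP le_rfl |>.trans_eq (one_mul _)
    _ = ‖v‖ ^ 2 := (sq _).symm

variable {ι : Type*} {i : I} (b : HilbertBasis ι ℂ (H i)) {ξ : H i} (hξ : ‖ξ‖ = 1)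

/-- The slice map evaluating position `i` in the vector state of the unit vector `ξ`: it sends
`⨂ T j` to the scalar `⟪ξ, T i ξ⟫` times the same tensor with `T i` replaced by `1`. As a Kraus map
it is `T ↦ ∑ l, (u l)† T (u l)`, where `u l` is the rank-one operator `|ξ⟩⟨b l|` in position `i`. -/
noncomputable def slice :
    (HilbertTensor H →L[ℂ] HilbertTensor H) →ₗ[ℂ] (HilbertTensor H →L[ℂ] HilbertTensor H) :=
  krausMap (fun l => slot i (rankOne ℂ ξ (b l))) (sum_norm_sq_slot_rankOne_le b.orthonormal hξ)

theorem norm_slice_le (T : HilbertTensor H →L[ℂ] HilbertTensor H) : ‖slice b hξ T‖ ≤ ‖T‖ :=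
  norm_krausMap_le _ _ T

theorem inner_slice_pureTensor [DecidableEq I] (T : HilbertTensor H →L[ℂ] HilbertTensor H)
    (x y : ∀ i, H i) :
    ⟪pureTensor y, slice b hξ T (pureTensor x)⟫_ℂ = ⟪y i, x i⟫_ℂ *
      ⟪pureTensor (Function.update y i ξ), T (pureTensor (Function.update x i ξ))⟫_ℂ := by
  refine (hasSum_inner_krausMap _ _ T _ _).unique ?_
  have h := (b.hasSum_inner_mul_inner (y i) (x i)).mul_right
    ⟪pureTensor (Function.update y i ξ), T (pureTensor (Function.update x i ξ))⟫_ℂ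
  refine h.congr_fun fun l => ?_
  simp [slot_pureTensor, inner_smul_left, inner_smul_right, mul_left_comm, mul_assoc]

theorem slice_of_commute {c : HilbertTensor H →L[ℂ] HilbertTensor H}
    (hc : ∀ T : H i →L[ℂ] H i, Commute c (slot i T)) : slice b hξ c = c := by
  classical
  refine ext_inner_pureTensor_map fun x y => ?_
  have hx : slot i (rankOne ℂ (x i) ξ) (pureTensor (Function.update x i ξ)) = pureTensor x := by
    simp [slot_pureTensor, inner_self_eq_norm_sq_to_K, hξ]
  have hy : slot i (rankOne ℂ ξ (x i)) (pureTensor y) =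
      ⟪x i, y i⟫_ℂ • pureTensor (Function.update y i ξ) := by
    simp [slot_pureTensor]
  calc ⟪pureTensor y, slice b hξ c (pureTensor x)⟫_ℂ
      = ⟪slot i (rankOne ℂ ξ (x i)) (pureTensor y),
          c (pureTensor (Function.update x i ξ))⟫_ℂ := by
        rw [inner_slice_pureTensor, hy, inner_smul_left, inner_conj_symm]
    _ = ⟪pureTensor y, slot i (rankOne ℂ (x i) ξ) (c (pureTensor (Function.update x i ξ)))⟫_ℂ := by
        rw [← InnerProductSpace.adjoint_rankOne, ← ContinuousLinearMap.star_eq_adjoint, ← star_slot,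
          ContinuousLinearMap.star_eq_adjoint, ContinuousLinearMap.adjoint_inner_left]
    _ = ⟪pureTensor y, c (pureTensor x)⟫_ℂ := by
        rw [← mul_apply_eq_comp, ← (hc _).eq, mul_apply_eq_comp, hx]

theorem norm_slice_sub_le (a T : HilbertTensor H →L[ℂ] HilbertTensor H)
    {c : HilbertTensor H →L[ℂ] HilbertTensor H}
    (hc : ∀ S : H i →L[ℂ] H i, Commute c (slot i S)) :
    ‖slice b hξ T - a‖ ≤ ‖T - a‖ + 2 * ‖a - c‖ := by
  calc ‖slice b hξ T - a‖
      = ‖slice b hξ (T - a) + slice b hξ (a - c) - (a - c)‖ := by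
        rw [map_sub, map_sub, slice_of_commute b hξ hc]
        congr 1
        abel
    _ ≤ ‖slice b hξ (T - a)‖ + ‖slice b hξ (a - c)‖ + ‖a - c‖ :=
        (norm_sub_le _ _).trans (by gcongr; exact norm_add_le _ _)
    _ ≤ ‖T - a‖ + ‖a - c‖ + ‖a - c‖ := by
        gcongr <;> exact norm_slice_le b hξ _
    _ = ‖T - a‖ + 2 * ‖a - c‖ := by ring

theorem exists_iterated_slice [DecidableEq I] {ξ : ∀ i, H i} (hξ : ∀ i, ‖ξ i‖ = 1)
    (a : HilbertTensor H →L[ℂ] HilbertTensor H) {c : I → HilbertTensor H →L[ℂ] HilbertTensor H}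
    (hc : ∀ i (T : H i →L[ℂ] H i), Commute (c i) (slot i T)) (S : Finset I) :
    ∃ b : HilbertTensor H →L[ℂ] HilbertTensor H,
      (∀ x y, ⟪pureTensor y, b (pureTensor x)⟫_ℂ = (∏ i ∈ S, ⟪y i, x i⟫_ℂ) *
        ⟪pureTensor (S.piecewise ξ y), a (pureTensor (S.piecewise ξ x))⟫_ℂ) ∧
      ‖b - a‖ ≤ ∑ i ∈ S, 2 * ‖a - c i‖ := by
  induction S using Finset.induction_on with
  | empty => exact ⟨a, by simp, by simp⟩
  | insert i S hi ih =>
    obtain ⟨b, hb, hba⟩ := ih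
    obtain ⟨_, e, -⟩ := exists_hilbertBasis ℂ (H i)
    refine ⟨slice e (hξ i) b, fun x y => ?_, ?_⟩
    · have hprod : ∏ j ∈ S, ⟪Function.update y i (ξ i) j, Function.update x i (ξ i) j⟫_ℂ =
          ∏ j ∈ S, ⟪y j, x j⟫_ℂ := Finset.prod_congr rfl fun j hj => by
        rw [Function.update_of_ne (ne_of_mem_of_not_mem hj hi),
          Function.update_of_ne (ne_of_mem_of_not_mem hj hi)]
      rw [inner_slice_pureTensor, hb, hprod, Finset.prod_insert hi, mul_assoc,
        Finset.piecewise_insert, Finset.piecewise_insert,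
        Finset.update_piecewise_of_notMem _ _ _ hi, Finset.update_piecewise_of_notMem _ _ _ hi]
    · rw [Finset.sum_insert hi, add_comm]
      exact (norm_slice_sub_le e (hξ i) a b (hc i)).trans (by gcongr)

theorem norm_sub_vectorState_smul_one_le {ξ : ∀ i, H i} (hξ : ∀ i, ‖ξ i‖ = 1)
    (a : HilbertTensor H →L[ℂ] HilbertTensor H) {c : I → HilbertTensor H →L[ℂ] HilbertTensor H}
    (hc : ∀ i (T : H i →L[ℂ] H i), Commute (c i) (slot i T)) :
    ‖a - ⟪pureTensor ξ, a (pureTensor ξ)⟫_ℂ • 1‖ ≤ ∑ i, 2 * ‖a - c i‖ := by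
  classical
  obtain ⟨b, hb, hba⟩ := exists_iterated_slice hξ a hc Finset.univ
  have hb_eq : b = ⟪pureTensor ξ, a (pureTensor ξ)⟫_ℂ • 1 :=
    ext_inner_pureTensor_map fun x y => by
      simp [hb, inner_smul_right, inner_pureTensor, mul_comm]
  rwa [← hb_eq, norm_sub_rev]

end Slice

section MinTensor

variable {I : Type*} [Fintype I] {A : I → Type*} [∀ i, CStarAlgebra (A i)]
  {H : I → Type*} [∀ i, NormedAddCommGroup (H i)] [∀ i, InnerProductSpace ℂ (H i)]
  [∀ i, CompleteSpace (H i)] (π : ∀ i, A i →⋆ₐ[ℂ] (H i →L[ℂ] H i))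

/-- The defining representation of the minimal tensor product on `⨂ H i`. -/
noncomputable def toOperator : MinTensor π →⋆ₐ[ℂ] (HilbertTensor H →L[ℂ] HilbertTensor H) :=
  (spatialSubalgebra π).subtype

theorem norm_toOperator (a : MinTensor π) : ‖toOperator π a‖ = ‖a‖ := rfl

theorem commute_toOperator_slot {i : I} {c : MinTensor π} (hc : c ∈ tilde π i)
    (T : H i →L[ℂ] H i) : Commute (toOperator π c) (slot i T) := by
  let Z := (StarSubalgebra.centralizer ℂ (Set.range (slot (H := H) i))).comap (toOperator π)
  have hgen : {x | ∃ (j : I) (a : A j), j ≠ i ∧ x = embed π j a} ⊆ Z := by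
    rintro _ ⟨j, a, hji, rfl⟩
    refine (StarSubalgebra.mem_centralizer_iff ℂ).2 ?_
    rintro _ ⟨S, rfl⟩
    rw [star_slot]
    exact ⟨slot_commute hji.symm _ _, slot_commute hji.symm _ _⟩
  have hZ : IsClosed (Z : Set (MinTensor π)) :=
    (Set.isClosed_centralizer _).preimage continuous_subtype_val
  have hcZ : c ∈ Z := StarSubalgebra.topologicalClosure_minimal (StarAlgebra.adjoin_le hgen) hZ hc
  exact ((StarSubalgebra.mem_centralizer_iff ℂ).1 hcZ _ ⟨T, rfl⟩).1.symm

/-- The C⋆-subalgebra `⨂_{j ≠ i} A j` as a linear subspace of `⨂ A i`. -/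
noncomputable abbrev tildeSubmodule (i : I) : Submodule ℂ (MinTensor π) :=
  Subalgebra.toSubmodule (tilde π i).toSubalgebra

instance isClosed_tildeSubmodule (i : I) : IsClosed (tildeSubmodule π i : Set (MinTensor π)) :=
  StarSubalgebra.isClosed_topologicalClosure _

/-- Twice the quotient map modulo `⨂_{j ≠ i} A j`; the factor makes its norm the seminorm `L_i`. -/
noncomputable def scaledQuotientMap (i : I) : MinTensor π →L[ℂ] MinTensor π ⧸ tildeSubmodule π i :=
  (2 : ℂ) • (tildeSubmodule π i).mkQL

theorem norm_scaledQuotientMap (i : I) (a : MinTensor π) :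
    ‖scaledQuotientMap π i a‖ = partialSeminorm π i a := by
  have h : ‖(tildeSubmodule π i).mkQ a‖ = ⨅ c : tilde π i, ‖a - (c : MinTensor π)‖ := by
    simp_rw [← dist_eq_norm]
    exact (QuotientAddGroup.norm_mk a).trans Metric.infDist_eq_iInf
  simp [scaledQuotientMap, partialSeminorm, norm_smul, ← h]

theorem scaledQuotientMap_of_mem_tilde {i : I} {c : MinTensor π} (hc : c ∈ tilde π i) :
    scaledQuotientMap π i c = 0 := by
  have h : (tildeSubmodule π i).mkQ c = 0 := (Submodule.Quotient.mk_eq_zero _).2 hc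
  exact (congrArg ((2 : ℂ) • ·) h).trans (smul_zero _)

theorem partialSeminorm_le_hammingSeminorm (i : I) (a : MinTensor π) :
    partialSeminorm π i a ≤ hammingSeminorm π a :=
  le_ciSup (f := fun i => partialSeminorm π i a) (Set.finite_range _).bddAbove i

theorem norm_pi_scaledQuotientMap (a : MinTensor π) :
    ‖fun i => scaledQuotientMap π i a‖ = hammingSeminorm π a := by
  have h₀ : 0 ≤ hammingSeminorm π a :=
    Real.iSup_nonneg fun i => norm_scaledQuotientMap π i a ▸ norm_nonneg _
  refine le_antisymm ((pi_norm_le_iff_of_nonneg h₀).2 fun i => ?_)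
    (Real.iSup_le (fun i => ?_) (norm_nonneg _))
  · rw [norm_scaledQuotientMap]
    exact partialSeminorm_le_hammingSeminorm π i a
  · rw [← norm_scaledQuotientMap]
    exact norm_le_pi_norm (fun i => scaledQuotientMap π i a) i

theorem exists_norm_sub_smul_one_le (a : MinTensor π) :
    ∃ z : ℂ, ‖a - z • 1‖ ≤ ∑ i, partialSeminorm π i a := by
  by_cases hH : ∀ i, Nontrivial (H i)
  · choose ξ hξ using fun i => exists_norm_eq (H i) zero_le_one
    refine ⟨⟪pureTensor ξ, toOperator π a (pureTensor ξ)⟫_ℂ,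
      le_sum_of_forall_gt_le_sum fun g hg => ?_⟩
    have hc (i : I) : ∃ c : tilde π i, 2 * ‖a - c‖ < g i := by
      simpa only [partialSeminorm, Real.mul_iInf_of_nonneg zero_le_two] using
        exists_lt_of_ciInf_lt ((Real.mul_iInf_of_nonneg zero_le_two _).symm.trans_lt (hg i))
    choose c hc using hc
    have h := norm_sub_vectorState_smul_one_le hξ (toOperator π a)
      fun i => commute_toOperator_slot π (c i).2
    rw [← norm_toOperator, map_sub, map_smul, map_one]
    refine h.trans (Finset.sum_le_sum fun i _ => ?_)
    rw [← map_sub, norm_toOperator]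
    exact (hc i).le
  · obtain ⟨i, hi⟩ := not_forall.1 hH
    rw [not_nontrivial_iff_subsingleton] at hi
    have ha : toOperator π a = 0 := ext_pureTensor fun x => by
      rw [pureTensor.map_coord_zero i (Subsingleton.elim _ _), map_zero, map_zero]
    refine ⟨0, ?_⟩
    rw [zero_smul, sub_zero, ← norm_toOperator, ha, norm_zero]
    exact Finset.sum_nonneg fun i _ => norm_scaledQuotientMap π i a ▸ norm_nonneg _

theorem enorm_apply_le_dualNorm {L : MinTensor π → ℝ} (φ : M0 π) {a : MinTensor π}
    (ha : L a ≤ 1) : ‖(φ : MinTensor π →L[ℂ] ℂ) a‖ₑ ≤ dualNorm π L φ :=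
  le_iSup₂ (f := fun (b : MinTensor π) (_ : L b ≤ 1) => ‖(φ : MinTensor π →L[ℂ] ℂ) b‖ₑ) a ha

theorem dualNorm_le_ofReal {L : MinTensor π → ℝ} {φ : M0 π} {C : ℝ} (hC : 0 ≤ C)
    (h : ∀ a, ‖(φ : MinTensor π →L[ℂ] ℂ) a‖ ≤ C * L a) :
    dualNorm π L φ ≤ ENNReal.ofReal C := by
  refine iSup₂_le fun a ha => ?_
  rw [← ofReal_norm]
  exact ENNReal.ofReal_le_ofReal ((h a).trans (mul_le_of_le_one_right hC ha))

theorem dualNorm_hammingSeminorm_lt_top (φ : M0 π) :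
    dualNorm π (hammingSeminorm π) φ < ⊤ := by
  refine (dualNorm_le_ofReal π (C := ‖(φ : MinTensor π →L[ℂ] ℂ)‖ * Fintype.card I)
    (by positivity) fun a => ?_).trans_lt ENNReal.ofReal_lt_top
  obtain ⟨z, hz⟩ := exists_norm_sub_smul_one_le π a
  calc ‖(φ : MinTensor π →L[ℂ] ℂ) a‖
      = ‖(φ : MinTensor π →L[ℂ] ℂ) (a - z • 1)‖ := by rw [map_sub, φ.2 z, sub_zero]
    _ ≤ ‖(φ : MinTensor π →L[ℂ] ℂ)‖ * ∑ i, partialSeminorm π i a :=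
        ContinuousLinearMap.le_opNorm_of_le _ hz
    _ ≤ ‖(φ : MinTensor π →L[ℂ] ℂ)‖ * ∑ _i : I, hammingSeminorm π a := by
        gcongr with i
        exact partialSeminorm_le_hammingSeminorm π i a
    _ = ‖(φ : MinTensor π →L[ℂ] ℂ)‖ * Fintype.card I * hammingSeminorm π a := by
        simp [mul_assoc]

theorem dualNorm_partialSeminorm_lt_top (i : I) (ψ : tildePerp π i) :
    dualNorm π (partialSeminorm π i) ψ < ⊤ := by
  set f : MinTensor π →L[ℂ] ℂ := (ψ : M0 π).1
  refine (dualNorm_le_ofReal π (norm_nonneg f) fun a => ?_).trans_lt ENNReal.ofReal_lt_top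
  rw [partialSeminorm, Real.mul_iInf_of_nonneg zero_le_two,
    Real.mul_iInf_of_nonneg (norm_nonneg f)]
  refine le_ciInf fun c => ?_
  calc ‖f a‖ = ‖f (a - c)‖ := by rw [map_sub, ψ.2 c c.2, sub_zero]
    _ ≤ ‖f‖ * ‖a - c‖ := f.le_opNorm _
    _ ≤ ‖f‖ * (2 * ‖a - c‖) := by
        gcongr
        exact le_mul_of_one_le_left (norm_nonneg _) one_le_two

theorem dualNorm_sum_le (ψ : ∀ i, tildePerp π i) :
    dualNorm π (hammingSeminorm π) (∑ i, (ψ i : M0 π)) ≤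
      ∑ i, dualNorm π (partialSeminorm π i) (ψ i) := by
  refine iSup₂_le fun a ha => ?_
  rw [Submodule.coe_sum, sum_apply]
  exact (enorm_sum_le _ _).trans (Finset.sum_le_sum fun i _ =>
    enorm_apply_le_dualNorm π _ ((partialSeminorm_le_hammingSeminorm π i a).trans ha))

theorem norm_apply_le_dualNorm_mul (φ : M0 π) (a : MinTensor π) :
    ‖(φ : MinTensor π →L[ℂ] ℂ) a‖ ≤
      (dualNorm π (hammingSeminorm π) φ).toReal * ‖fun i => scaledQuotientMap π i a‖ := by
  refine norm_le_mul_of_forall_norm_le_one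
    (T := LinearMap.pi fun i => (scaledQuotientMap π i).toLinearMap)
    (f := (φ : MinTensor π →L[ℂ] ℂ).toLinearMap) (fun b hb => ?_) a
  rw [← toReal_enorm]
  exact ENNReal.toReal_mono (dualNorm_hammingSeminorm_lt_top π φ).ne
    (enorm_apply_le_dualNorm π φ ((norm_pi_scaledQuotientMap π b).symm.trans_le hb))

/-- The functional on `⨂ A i` vanishing on `⨂_{j ≠ i} A j` that a functional on the quotient
induces. -/
noncomputable def tildePerpOfDual (i : I) (F : StrongDual ℂ (MinTensor π ⧸ tildeSubmodule π i)) :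
    tildePerp π i :=
  have hF (c : MinTensor π) (hc : c ∈ tilde π i) : (F ∘L scaledQuotientMap π i) c = 0 :=
    (congrArg F (scaledQuotientMap_of_mem_tilde π hc)).trans (map_zero F)
  ⟨⟨F ∘L scaledQuotientMap π i, fun z => hF _ ((tilde π i).smul_mem (one_mem _) z)⟩, hF⟩

theorem dualNorm_tildePerpOfDual_le (i : I)
    (F : StrongDual ℂ (MinTensor π ⧸ tildeSubmodule π i)) :
    dualNorm π (partialSeminorm π i) (tildePerpOfDual π i F) ≤ ENNReal.ofReal ‖F‖ :=
  dualNorm_le_ofReal π (norm_nonneg F) fun a => by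
    rw [← norm_scaledQuotientMap]
    exact F.le_opNorm _

theorem exists_sum_dualNorm_le (φ : M0 π) :
    ∃ ψ : ∀ i, tildePerp π i, φ = ∑ i, (ψ i : M0 π) ∧
      ∑ i, dualNorm π (partialSeminorm π i) (ψ i) ≤ dualNorm π (hammingSeminorm π) φ := by
  obtain ⟨F, hφF, hF⟩ := exists_sum_comp_eq (φ := (φ : MinTensor π →L[ℂ] ℂ).toLinearMap)
    (T := fun i => (scaledQuotientMap π i).toLinearMap) ENNReal.toReal_nonneg
    (norm_apply_le_dualNorm_mul π φ)
  refine ⟨fun i => tildePerpOfDual π i (F i), ?_, ?_⟩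
  · ext a
    rw [Submodule.coe_sum, sum_apply]
    exact hφF a
  · calc ∑ i, dualNorm π (partialSeminorm π i) (tildePerpOfDual π i (F i))
        ≤ ∑ i, ENNReal.ofReal ‖F i‖ :=
          Finset.sum_le_sum fun i _ => dualNorm_tildePerpOfDual_le π i (F i)
      _ = ENNReal.ofReal (∑ i, ‖F i‖) :=
          (ENNReal.ofReal_sum_of_nonneg fun i _ => norm_nonneg _).symm
      _ ≤ dualNorm π (hammingSeminorm π) φ := ENNReal.ofReal_le_of_le_toReal hF

end MinTensor

end QuantumHamming

open QuantumHamming in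
theorem mainTheorem7_general {I : Type*} [Fintype I] {A : I → Type*} [∀ i, CStarAlgebra (A i)]
    {H : I → Type*} [∀ i, NormedAddCommGroup (H i)] [∀ i, InnerProductSpace ℂ (H i)]
    [∀ i, CompleteSpace (H i)] (π : ∀ i, A i →⋆ₐ[ℂ] (H i →L[ℂ] H i)) (φ : M0 π) :
    dualNorm π (hammingSeminorm π) φ < ⊤ ∧
    (∀ (i : I) (ψ : tildePerp π i), dualNorm π (partialSeminorm π i) ψ < ⊤) ∧
    dualNorm π (hammingSeminorm π) φ =
      ⨅ (ψ : ∀ i, tildePerp π i) (_ : φ = ∑ i, (ψ i : M0 π)),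
        ∑ i, dualNorm π (partialSeminorm π i) (ψ i) := by
  refine ⟨dualNorm_hammingSeminorm_lt_top π φ, dualNorm_partialSeminorm_lt_top π,
    le_antisymm (le_iInf₂ fun ψ hψ => hψ ▸ dualNorm_sum_le π ψ) ?_⟩
  obtain ⟨ψ, hψ, hle⟩ := exists_sum_dualNorm_le π φ
  exact (iInf₂_le ψ hψ).trans hle

theorem mainTheorem7 {I : Type*} [Fintype I] {A : I → Type*} [∀ i, CStarAlgebra (A i)]
    {H : I → Type*} [∀ i, NormedAddCommGroup (H i)] [∀ i, InnerProductSpace ℂ (H i)]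
    [∀ i, CompleteSpace (H i)] (π : ∀ i, A i →⋆ₐ[ℂ] (H i →L[ℂ] H i))
    (hπ : ∀ i, Function.Injective (π i)) (φ : QuantumHamming.M0 π) :
    QuantumHamming.dualNorm π (QuantumHamming.hammingSeminorm π) φ < ⊤ ∧
    (∀ (i : I) (ψ : QuantumHamming.tildePerp π i),
      QuantumHamming.dualNorm π (QuantumHamming.partialSeminorm π i) ψ < ⊤) ∧
    QuantumHamming.dualNorm π (QuantumHamming.hammingSeminorm π) φ =
      ⨅ (ψ : ∀ i, QuantumHamming.tildePerp π i) (_ : φ = ∑ i, (ψ i : QuantumHamming.M0 π)),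
        ∑ i, QuantumHamming.dualNorm π (QuantumHamming.partialSeminorm π i) (ψ i) :=
  mainTheorem7_general π φ
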